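/- Let $k$ be a field that is complete with respect to a nontrivial non-Archimedean absolute value, let $\mathfrak{o}_k=\{a\in k:|a|\le 1\}$ be its valuation ring, and let $$F=\sum_{i_1,\dots,i_l\ge 0} c_{i_1\cdots i_l}\,x_1^{i_1}\cdots x_l^{i_l}\in k\langle x_1,\dots,x_l\rangle$$ be a restricted power series, i.e. a formal power series with $c_{i_1\cdots i_l}\to 0$ as $i_1+\dots+i_l\to\infty$ (so that the series converges on $\mathfrak{o}_k^l$). For $n\in\{1,\dots,l\}$ and $a=(a_1,\dots,a_l)\in\mathfrak{o}_k^l$ let $$F_{n,a}=\sum_{j=0}^{\infty}\Big(\sum_{\substack{i_1,\dots,i_l\ge 0\\ i_n=j}} c_{i_1\cdots i_l}\prod_{m\ne n}a_m^{i_m}\Big)x_n^{j}\in k[[x_n]]$$ be the power series obtained from $F$ by substituting $a_m$ for $x_m$ for all $m\neq n$. Suppose that $F_{n,a}\in k(x_n)$ for every $n\in\{1,\dots,l\}$ and every $a\in\mathfrak{o}_k^l$, i.e. that $F_{n,a}$ is a quotient of two polynomials in $k[x_n]$ with nonzero denominator. Then $F\in k(x_1,\dots,x_l)$, i.e. $F$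 is, in the fraction field of $k[[x_1,\dots,x_l]]$, a quotient of two polynomials in $k[x_1,\dots,x_l]$ with nonzero denominator. -/

import Mathlib

/-- A power series `F` in `x₁, …, x_l` over a field `k` lies in `k(x₁, …, x_l)`: in the fraction
field of `k⟦x₁, …, x_l⟧` it is the quotient of two polynomials. -/
def MvPowerSeries.IsRationalFunction {k : Type*} [Field k] {l : ℕ}
    (F : MvPowerSeries (Fin l) k) : Prop :=
  ∃ p q : MvPolynomial (Fin l) k, q ≠ 0 ∧
    algebraMap (MvPowerSeries (Fin l) k) (FractionRing (MvPowerSeries (Fin l) k)) F =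
      algebraMap _ (FractionRing (MvPowerSeries (Fin l) k)) (p : MvPowerSeries (Fin l) k) /
        algebraMap _ (FractionRing (MvPowerSeries (Fin l) k)) (q : MvPowerSeries (Fin l) k)

/-- A power series `f` in one variable `x` over a field `k` lies in `k(x)`: in the fraction
field of `k⟦x⟧` it is the quotient of two polynomials. -/
def PowerSeries.IsRationalFunction {k : Type*} [Field k] (f : PowerSeries k) : Prop :=
  ∃ p q : Polynomial k, q ≠ 0 ∧
    algebraMap (PowerSeries k) (FractionRing (PowerSeries k)) f =
      algebraMap _ (FractionRing (PowerSeries k)) (p : PowerSeries k) /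
        algebraMap _ (FractionRing (PowerSeries k)) (q : PowerSeries k)

/-- The power series in the single variable `x_n` obtained from `F = ∑ c_d x^d` by substituting
`a_m` for `x_m` for every `m ≠ n`: its `j`-th coefficient is the sum of
`c_d * ∏_{m ≠ n} a_m ^ d_m` over all multi-indices `d` with `d_n = j`. The value `a_n` plays
no role. -/
noncomputable def MvPowerSeries.specializeExcept {k : Type*} [NormedField k] {l : ℕ}
    (F : MvPowerSeries (Fin l) k) (n : Fin l) (a : Fin l → k) : PowerSeries k :=
  PowerSeries.mk fun j =>
    ∑' d : {d : Fin l →₀ ℕ // d n = j},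
      MvPowerSeries.coeff d.1 F * ∏ m ∈ Finset.univ.erase n, a m ^ d.1 m

/-- The sums defining the coefficients of `specializeExcept` converge when `F` is a restricted power
series over a complete non-Archimedean field and `a` has coordinates in the valuation ring. -/
theorem MvPowerSeries.summable_specializeExcept {k : Type*} [NormedField k] [IsUltrametricDist k]
    [CompleteSpace k] {l : ℕ} (F : MvPowerSeries (Fin l) k)
    (hF : MvPowerSeries.IsRestricted (fun _ => 1) F) (n : Fin l) (a : Fin l → k)
    (ha : ∀ m, ‖a m‖ ≤ 1) (j : ℕ) :
    Summable fun d : {d : Fin l →₀ ℕ // d n = j} =>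
      MvPowerSeries.coeff d.1 F * ∏ m ∈ Finset.univ.erase n, a m ^ d.1 m := by
  apply NonarchimedeanAddGroup.summable_of_tendsto_cofinite_zero
  have h0 : Filter.Tendsto (fun d : Fin l →₀ ℕ => ‖MvPowerSeries.coeff d F‖) Filter.cofinite
      (nhds 0) := by
    simpa [MvPowerSeries.IsRestricted] using hF
  have h1 := h0.comp (Subtype.val_injective (p := fun d : Fin l →₀ ℕ => d n = j)).tendsto_cofinite
  refine squeeze_zero_norm (fun d => ?_) h1
  rw [norm_mul, norm_prod]
  refine mul_le_of_le_one_right (norm_nonneg _) (Finset.prod_le_one (fun _ _ => norm_nonneg _) ?_)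
  intro m _
  rw [norm_pow]
  exact pow_le_one₀ (norm_nonneg _) (ha m)

/-! Induction on the number of variables. Write `F` as a series `f` in `x₁, …, x_l` with
coefficients in `k⟨x₀⟩`. For each `x` in the unit ball, `F(x, ·)` inherits the hypotheses, so by
induction it is a quotient of polynomials. The exponents occurring in such a quotient form a finite
set. There are only countably many such sets and the ball is uncountable, so one set `s` serves
infinitely many `x` (`Set.exists_infinite_fiber_of_not_countable`).

For fixed `s`, being a quotient of polynomials with exponents in `s` is a homogeneous linear system
for the denominator, and a nonzero solution exists exactly when all maximal minors vanish. These
minors are restricted series in `x₀` with infinitely many zeros, hence zero by Strassmann's theorem.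
So `f` is a quotient of polynomials over `k⟦x₀⟧` (`exists_mul_eq_coe_of_infinite`).

It remains to make the coefficients polynomial in `x₀`
(`exists_mul_map_eq_map_of_isRationalFunction`). The specializations at points `a` of the other
variables are rational in `x₀`. They give a linear system over `k[x₀]` that is solvable over
`k⟦x₀⟧`; by minors again, it is solvable over `k[x₀]`. -/

open Filter Topology

/-! ### Linear algebra: maximal minors and kernel vectors -/

/-- Rows spanning `K ^ ι` contain a nonvanishing maximal minor. -/
theorem Matrix.exists_det_submatrix_ne_zero_of_span_eq_top {K ρ ι : Type*} [Field K] [Fintype ι]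
    [DecidableEq ι] (N : Matrix ρ ι K) (htop : Submodule.span K (Set.range N.row) = ⊤) :
    ∃ g : ι → ρ, (N.submatrix g id).det ≠ 0 := by
  obtain ⟨b, hb, hbspan, hbli⟩ := exists_linearIndependent K (Set.range N.row)
  let B := Module.Basis.mk hbli (by simp [hbspan, htop])
  let e : ι ≃ b := (Pi.basisFun K ι).indexEquiv B
  choose g hg using fun i => hb (e i).2
  refine ⟨g, ?_⟩
  have hli : LinearIndependent K (N.submatrix g id).row := by
    have hrow : (N.submatrix g id).row = Subtype.val ∘ e := by
      ext i j
      simp [← hg]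
    rw [hrow]
    exact hbli.comp e e.injective
  rw [Matrix.linearIndependent_rows_iff_isUnit, Matrix.isUnit_iff_isUnit_det] at hli
  exact hli.ne_zero

/-- A matrix with finitely many columns over a domain all of whose maximal minors vanish has a
nonzero kernel vector. -/
theorem Matrix.exists_mulVec_eq_zero_of_forall_det_eq_zero {A ρ ι : Type*} [CommRing A]
    [IsDomain A] [Fintype ι] [DecidableEq ι] (M : Matrix ρ ι A)
    (h : ∀ g : ι → ρ, (M.submatrix g id).det = 0) : ∃ v : ι → A, v ≠ 0 ∧ M.mulVec v = 0 := by
  let K := FractionRing A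
  let N : Matrix ρ ι K := M.map (algebraMap A K)
  have hspan : Submodule.span K (Set.range N.row) ≠ ⊤ := by
    intro htop
    obtain ⟨g, hg⟩ := N.exists_det_submatrix_ne_zero_of_span_eq_top htop
    apply hg
    have := RingHom.map_det (algebraMap A K) (M.submatrix g id)
    rw [h g, map_zero] at this
    exact this.symm
  -- A nonzero functional killing all rows; its values on the standard basis, cleared of
  -- denominators, form the kernel vector.
  obtain ⟨φ, hφ, hle⟩ := Submodule.exists_le_ker_of_lt_top _ (lt_top_iff_ne_top.mpr hspan)
  obtain ⟨c, hc⟩ := IsLocalization.exist_integer_multiples_of_finite (nonZeroDivisors A)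
    (fun j : ι => φ (Pi.single j 1))
  choose v hv using hc
  have hc0 : algebraMap A K c ≠ 0 := by
    simp
  have key (x : ι → K) : φ x = ∑ j, x j * φ (Pi.single j 1) := by
    conv_lhs => rw [← (Pi.basisFun K ι).sum_repr x]
    simp
  refine ⟨v, ?_, ?_⟩
  · rintro rfl
    apply hφ
    ext x
    have hz (j : ι) : φ (Pi.single j 1) = 0 := by
      have := hv j
      simp only [Pi.zero_apply, map_zero, Algebra.smul_def] at this
      exact (mul_eq_zero.mp this.symm).resolve_left hc0
    simp [hz]
  · ext r
    apply FaithfulSMul.algebraMap_injective A K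
    have h0 : φ (N.row r) = 0 := hle (Submodule.subset_span ⟨r, rfl⟩)
    rw [key] at h0
    simp only [Matrix.mulVec, dotProduct, map_sum, map_mul, hv, Pi.zero_apply, map_zero,
      Algebra.smul_def]
    calc _ = algebraMap A K c * ∑ j, N.row r j * φ (Pi.single j 1) := by
          rw [Finset.mul_sum]
          exact Finset.sum_congr rfl fun j _ => by simp only [N, Matrix.row, Matrix.map_apply]; ring
      _ = 0 := by rw [h0, mul_zero]

theorem Matrix.det_submatrix_eq_zero_of_mulVec_eq_zero {A ρ ι : Type*} [CommRing A]
    [IsDomain A] [Fintype ι] [DecidableEq ι] (M : Matrix ρ ι A) {v : ι → A} (hv : v ≠ 0)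
    (h : M.mulVec v = 0) (g : ι → ρ) : (M.submatrix g id).det = 0 := by
  rw [← Matrix.exists_mulVec_eq_zero_iff]
  refine ⟨v, hv, ?_⟩
  ext i
  exact congrFun h (g i)

/-! ### Restricted series in one variable and Strassmann's theorem -/

section Ultrametric

variable {k : Type*} [NormedField k]

theorem norm_mul_pow_le (c : k) {x : k} (hx : ‖x‖ ≤ 1) (n : ℕ) : ‖c * x ^ n‖ ≤ ‖c‖ := by
  rw [norm_mul, norm_pow]
  exact mul_le_of_le_one_right (norm_nonneg _) (pow_le_one₀ (norm_nonneg _) hx)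

theorem PowerSeries.IsRestricted.tendsto_coeff {f : PowerSeries k} (hf : f.IsRestricted 1) :
    Tendsto (fun n => PowerSeries.coeff n f) atTop (𝓝 0) := by
  rw [tendsto_zero_iff_norm_tendsto_zero]
  simpa using (PowerSeries.isRestricted_iff' 1 f).mp hf

variable [IsUltrametricDist k]

/-- A null series whose terms are smaller than `r` has sum smaller than `r`. -/
theorem norm_tsum_lt {c : ℕ → k} (hc : Tendsto c atTop (𝓝 0)) {r : ℝ}
    (h : ∀ n, ‖c n‖ < r) : ‖∑' n, c n‖ < r := by
  have hr : 0 < r := (norm_nonneg _).trans_lt (h 0)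
  obtain ⟨N, hN⟩ := eventually_atTop.mp
    ((tendsto_zero_iff_norm_tendsto_zero.mp hc).eventually_lt_const (half_pos hr))
  -- Only finitely many terms exceed `r / 2`, and their maximum is still below `r`; this keeps the
  -- inequality strict.
  let s := (Finset.range (N + 1)).sup' ⟨0, by simp⟩ fun n => ‖c n‖
  have hs : s < r := (Finset.sup'_lt_iff _).mpr fun n _ => h n
  refine lt_of_le_of_lt (IsUltrametricDist.norm_tsum_le_of_forall_le (C := max s (r / 2)) ?_)
    (max_lt hs (half_lt_self hr))
  intro n
  rcases le_or_gt N n with hn | hn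
  · exact (hN n hn).le.trans (le_max_right _ _)
  · exact (Finset.le_sup' (fun n => ‖c n‖) (Finset.mem_range.mpr (by omega))).trans
      (le_max_left _ _)

theorem PowerSeries.IsRestricted.tendsto_coeff_coe (f : subring (R := k) 1) :
    Tendsto (fun n => PowerSeries.coeff n (f : PowerSeries k)) atTop (𝓝 0) :=
  tendsto_coeff f.2

variable [CompleteSpace k]

theorem summable_mul_of_tendsto_zero {ι : Type*} {c x : ι → k} (hc : Tendsto c cofinite (𝓝 0))
    (hx : ∀ i, ‖x i‖ ≤ 1) : Summable fun i => c i * x i := by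
  apply NonarchimedeanAddGroup.summable_of_tendsto_cofinite_zero
  refine squeeze_zero_norm (fun i => ?_) (tendsto_zero_iff_norm_tendsto_zero.mp hc)
  rw [norm_mul]
  exact mul_le_of_le_one_right (norm_nonneg _) (hx i)

theorem summable_mul_pow {c : ℕ → k} (hc : Tendsto c atTop (𝓝 0)) {x : k} (hx : ‖x‖ ≤ 1) :
    Summable fun n => c n * x ^ n := by
  rw [← Nat.cofinite_eq_atTop] at hc
  exact summable_mul_of_tendsto_zero hc fun n => by
    rw [norm_pow]; exact pow_le_one₀ (norm_nonneg _) hx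

/-- The two relations compare the coefficients of `c` with those of `(x - b) * g`. -/
theorem tsum_mul_pow_eq_sub_mul_tsum {c g : ℕ → k} (hc : Tendsto c atTop (𝓝 0))
    (hg : Tendsto g atTop (𝓝 0)) {b x : k} (hx : ‖x‖ ≤ 1) (hg0 : c 0 + b * g 0 = 0)
    (hrec : ∀ j, g j = c (j + 1) + b * g (j + 1)) :
    ∑' n, c n * x ^ n = (x - b) * ∑' n, g n * x ^ n := by
  have hgx := summable_mul_pow hg hx
  have hs1 : Summable fun n => g (n + 1) * x ^ (n + 1) :=
    hgx.comp_injective (add_left_injective 1)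
  have hterm (n : ℕ) :
      c (n + 1) * x ^ (n + 1) = x * (g n * x ^ n) - b * (g (n + 1) * x ^ (n + 1)) := by
    rw [hrec n, pow_succ]
    ring
  have h0 : ∑' n, g n * x ^ n = g 0 + ∑' n, g (n + 1) * x ^ (n + 1) := by
    simpa using hgx.tsum_eq_zero_add
  have h1 : ∑' n, c n * x ^ n = c 0 + ∑' n, c (n + 1) * x ^ (n + 1) := by
    simpa using (summable_mul_pow hc hx).tsum_eq_zero_add
  have h2 : ∑' n, c (n + 1) * x ^ (n + 1) =
      x * ∑' n, g n * x ^ n - b * ∑' n, g (n + 1) * x ^ (n + 1) := by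
    rw [tsum_congr hterm]
    exact ((hgx.hasSum.mul_left x).sub (hs1.hasSum.mul_left b)).tsum_eq
  linear_combination h1 + h2 + hg0 + b * h0

/-- **Strassmann's theorem**, qualitative form. -/
theorem finite_setOf_tsum_mul_pow_eq_zero_of_forall_lt (N : ℕ) (c : ℕ → k)
    (hc : Tendsto c atTop (𝓝 0)) (hN0 : c N ≠ 0) (hN : ∀ n, N < n → ‖c n‖ < ‖c N‖) :
    {x : k | ‖x‖ ≤ 1 ∧ ∑' n, c n * x ^ n = 0}.Finite := by
  induction N generalizing c with
  | zero =>
    convert Set.finite_empty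
    ext x
    simp only [Set.mem_ofPred_eq, Set.mem_empty_iff_false, iff_false, not_and]
    intro hx h0
    have hs := summable_mul_pow hc hx
    rw [hs.tsum_eq_zero_add, pow_zero, mul_one] at h0
    have : ‖∑' n, c (n + 1) * x ^ (n + 1)‖ < ‖c 0‖ := by
      refine norm_tsum_lt ?_ fun n => (norm_mul_pow_le _ hx _).trans_lt (hN _ n.succ_pos)
      exact (tendsto_add_atTop_iff_nat 1).mpr hs.tendsto_atTop_zero
    rw [← neg_eq_of_add_eq_zero_right h0, norm_neg] at this
    exact lt_irrefl _ this
  | succ N ih =>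
    by_cases hb : ∃ b : k, ‖b‖ ≤ 1 ∧ ∑' n, c n * b ^ n = 0
    swap
    · convert Set.finite_empty
      ext x
      simp only [Set.mem_ofPred_eq, Set.mem_empty_iff_false, iff_false]
      exact fun h => hb ⟨x, h⟩
    obtain ⟨b, hb1, hb0⟩ := hb
    have hcs (j : ℕ) : Tendsto (fun n => c (n + j)) atTop (𝓝 0) :=
      (tendsto_add_atTop_iff_nat j).mpr hc
    -- The coefficients of the quotient by `x - b`, where `b` is a root.
    let g : ℕ → k := fun j => ∑' n, c (n + (j + 1)) * b ^ n
    have hrec (j : ℕ) : g j = c (j + 1) + b * g (j + 1) := by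
      simp only [g]
      rw [(summable_mul_pow (hcs (j + 1)) hb1).tsum_eq_zero_add, ← tsum_mul_left]
      simp only [zero_add, pow_zero, mul_one]
      congr 1
      refine tsum_congr fun n => ?_
      rw [pow_succ, show n + 1 + (j + 1) = n + (j + 1 + 1) by ring]
      ring
    have hg0 : c 0 + b * g 0 = 0 := by
      rw [← hb0, (summable_mul_pow hc hb1).tsum_eq_zero_add, ← tsum_mul_left]
      simp only [pow_zero, mul_one, zero_add]
      congr 1
      refine tsum_congr fun n => ?_
      rw [pow_succ]
      ring
    have hg : Tendsto g atTop (𝓝 0) := by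
      rw [Metric.tendsto_atTop]
      intro ε hε
      obtain ⟨M, hM⟩ := Metric.tendsto_atTop.mp hc ε hε
      refine ⟨M, fun j hj => ?_⟩
      rw [dist_zero_right]
      refine norm_tsum_lt (summable_mul_pow (hcs (j + 1)) hb1).tendsto_atTop_zero fun n =>
        (norm_mul_pow_le _ hb1 _).trans_lt ?_
      simpa using hM (n + (j + 1)) (by omega)
    have hglt (j : ℕ) (hj : N < j) : ‖g j‖ < ‖c (N + 1)‖ :=
      norm_tsum_lt (summable_mul_pow (hcs (j + 1)) hb1).tendsto_atTop_zero fun n =>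
        (norm_mul_pow_le _ hb1 _).trans_lt (hN _ (by omega))
    -- In `c (N + 1) + b * g (N + 1)` the second term is strictly smaller. Thus dividing by `x - b`
    -- lowers the dominating index by one.
    have hgN : ‖g N‖ = ‖c (N + 1)‖ := by
      have hlt : ‖b * g (N + 1)‖ < ‖c (N + 1)‖ := by
        rw [norm_mul]
        exact (mul_le_of_le_one_left (norm_nonneg _) hb1).trans_lt (hglt _ (by omega))
      rw [hrec N, IsUltrametricDist.norm_add_eq_max_of_norm_ne_norm hlt.ne', max_eq_left hlt.le]
    have hfin := ih g hg (by rw [← norm_ne_zero_iff, hgN]; simpa using hN0)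
      (fun n hn => by rw [hgN]; exact hglt n hn)
    refine (hfin.insert b).subset ?_
    rintro x ⟨hx, hx0⟩
    by_cases hxb : x = b
    · exact Or.inl hxb
    refine Or.inr ⟨hx, ?_⟩
    rw [tsum_mul_pow_eq_sub_mul_tsum hc hg hx hg0 hrec] at hx0
    exact (mul_eq_zero.mp hx0).resolve_left (sub_ne_zero.mpr hxb)

theorem eq_zero_of_infinite_setOf_tsum_mul_pow_eq_zero (c : ℕ → k) (hc : Tendsto c atTop (𝓝 0))
    (h : {x : k | ‖x‖ ≤ 1 ∧ ∑' n, c n * x ^ n = 0}.Infinite) : c = 0 := by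
  by_contra hne
  obtain ⟨m, hm⟩ : ∃ m, c m ≠ 0 := by
    by_contra! hall
    exact hne (funext hall)
  obtain ⟨M, hM⟩ := eventually_atTop.mp
    ((tendsto_zero_iff_norm_tendsto_zero.mp hc).eventually_lt_const (norm_pos_iff.mpr hm))
  -- The last index whose coefficient is at least as large as `c m` dominates all later ones.
  have hlast : ∃ N, ‖c m‖ ≤ ‖c N‖ ∧ ∀ n, N < n → ‖c n‖ < ‖c m‖ := by
    classical
    let P : ℕ → Prop := fun n => ‖c m‖ ≤ ‖c n‖
    have hmM : m ≤ M := by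
      by_contra! hlt
      exact lt_irrefl _ (hM m hlt.le)
    refine ⟨Nat.findGreatest P M, Nat.findGreatest_spec (P := P) hmM le_rfl, fun n hn => ?_⟩
    rcases le_or_gt M n with hMn | hMn
    · exact hM n hMn
    · exact not_le.mp (Nat.findGreatest_is_greatest (P := P) hn hMn.le)
  obtain ⟨N, hN1, hN2⟩ := hlast
  refine h (finite_setOf_tsum_mul_pow_eq_zero_of_forall_lt N c hc ?_ fun n hn =>
    (hN2 n hn).trans_le hN1)
  exact norm_pos_iff.mp ((norm_pos_iff.mpr hm).trans_le hN1)

theorem tsum_mul_tsum_mul_pow {c g : ℕ → k} (hc : Tendsto c atTop (𝓝 0))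
    (hg : Tendsto g atTop (𝓝 0)) {x : k} (hx : ‖x‖ ≤ 1) :
    (∑' n, c n * x ^ n) * ∑' n, g n * x ^ n =
      ∑' n, (∑ p ∈ Finset.HasAntidiagonal.antidiagonal n, c p.1 * g p.2) * x ^ n := by
  have : NonarchimedeanRing k := ⟨NonarchimedeanAddGroup.is_nonarchimedean⟩
  have hcx := summable_mul_pow hc hx
  have hgx := summable_mul_pow hg hx
  have hprod := hcx.mul_of_nonarchimedean hgx
  rw [hcx.tsum_mul_tsum_eq_tsum_sum_antidiagonal hgx hprod]
  refine tsum_congr fun n => ?_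
  rw [Finset.sum_mul]
  refine Finset.sum_congr rfl fun p hp => ?_
  rw [← Finset.HasAntidiagonal.mem_antidiagonal.mp hp, pow_add]
  ring

/-- Evaluation of restricted power series at a point of the closed unit ball. -/
noncomputable def PowerSeries.IsRestricted.evalHom (x : k) (hx : ‖x‖ ≤ 1) :
    PowerSeries.IsRestricted.subring (R := k) 1 →+* k where
  toFun f := ∑' n, PowerSeries.coeff n f.1 * x ^ n
  map_one' := by
    rw [tsum_eq_single 0]
    · simp
    · intro n hn
      simp [PowerSeries.coeff_one, hn]
  map_zero' := by simp
  map_add' f g := by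
    have hf := (summable_mul_pow (tendsto_coeff_coe f) hx).hasSum
    have hg := (summable_mul_pow (tendsto_coeff_coe g) hx).hasSum
    rw [← (hf.add hg).tsum_eq]
    exact tsum_congr fun n => by simp [add_mul]
  map_mul' f g := by
    rw [tsum_mul_tsum_mul_pow (tendsto_coeff_coe f) (tendsto_coeff_coe g) hx]
    exact tsum_congr fun n => by rw [Subring.coe_mul, PowerSeries.coeff_mul]

theorem PowerSeries.IsRestricted.eq_zero_of_infinite_evalHom_eq_zero
    (f : PowerSeries.IsRestricted.subring (R := k) 1) {T : Set k} (hT : T.Infinite)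
    (h : ∀ x ∈ T, ∃ hx : ‖x‖ ≤ 1, evalHom x hx f = 0) : f = 0 := by
  have := eq_zero_of_infinite_setOf_tsum_mul_pow_eq_zero _ (tendsto_coeff_coe f)
    (hT.mono fun x hx => ⟨(h x hx).choose, (h x hx).choose_spec⟩)
  ext n
  exact congrFun this n

end Ultrametric

/-! ### Clearing denominators and separating the first variable -/

namespace MvPowerSeries

theorem isRationalFunction_iff {k : Type*} [Field k] {l : ℕ} (F : MvPowerSeries (Fin l) k) :
    F.IsRationalFunction ↔
      ∃ p q : MvPolynomial (Fin l) k, q ≠ 0 ∧ F * (q : MvPowerSeries (Fin l) k) = p := by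
  refine exists_congr fun p => exists_congr fun q => and_congr_right fun hq => ?_
  have hinj := FaithfulSMul.algebraMap_injective (MvPowerSeries (Fin l) k)
    (FractionRing (MvPowerSeries (Fin l) k))
  have hq0 : algebraMap _ (FractionRing (MvPowerSeries (Fin l) k))
      (q : MvPowerSeries (Fin l) k) ≠ 0 := by
    rw [Ne, map_eq_zero_iff _ hinj]
    simpa using hq
  rw [eq_div_iff hq0, ← map_mul, hinj.eq_iff]

theorem _root_.PowerSeries.isRationalFunction_iff {k : Type*} [Field k] (f : PowerSeries k) :
    f.IsRationalFunction ↔ ∃ p q : Polynomial k, q ≠ 0 ∧ f * (q : PowerSeries k) = p := by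
  refine exists_congr fun p => exists_congr fun q => and_congr_right fun hq => ?_
  have hinj := FaithfulSMul.algebraMap_injective (PowerSeries k) (FractionRing (PowerSeries k))
  have hq0 : algebraMap _ (FractionRing (PowerSeries k)) (q : PowerSeries k) ≠ 0 := by
    rw [Ne, map_eq_zero_iff _ hinj]
    simpa using hq
  rw [eq_div_iff hq0, ← map_mul, hinj.eq_iff]

section SplitFirst

variable {R : Type*} [CommRing R] {l : ℕ}

/-- The map underlying `splitFirst`. -/
noncomputable def splitFirstFun (F : MvPowerSeries (Fin (l + 1)) R) :
    MvPowerSeries (Fin l) (PowerSeries R) :=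
  fun d => PowerSeries.mk fun j => coeff (d.cons j) F

theorem coeff_coeff_splitFirstFun (F : MvPowerSeries (Fin (l + 1)) R) (d : Fin l →₀ ℕ) (j : ℕ) :
    PowerSeries.coeff j (coeff d (splitFirstFun F)) = coeff (d.cons j) F :=
  PowerSeries.coeff_mk j fun j => coeff (d.cons j) F

/-- A power series in `x₀, …, x_l` as a power series in `x₁, …, x_l` with coefficients in
`R⟦x₀⟧`. -/
noncomputable def splitFirst :
    MvPowerSeries (Fin (l + 1)) R →+* MvPowerSeries (Fin l) (PowerSeries R) where
  toFun := splitFirstFun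
  map_one' := by
    classical
    ext d j
    rw [coeff_coeff_splitFirstFun, ← coeff_coeff_finSuccEquiv, map_one, coeff_one,
      PowerSeries.coeff_one]
    by_cases hd : d = 0 <;> by_cases hj : j = 0 <;> simp [hd, hj, PowerSeries.coeff_one, coeff_one]
  map_zero' := by
    ext d j
    simp [coeff_coeff_splitFirstFun]
  map_add' F G := by
    ext d j
    simp [coeff_coeff_splitFirstFun]
  map_mul' F G := by
    classical
    ext d j
    rw [coeff_mul, map_sum, coeff_coeff_splitFirstFun, ← coeff_coeff_finSuccEquiv, map_mul,
      PowerSeries.coeff_mul, map_sum]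
    simp_rw [coeff_mul, PowerSeries.coeff_mul, coeff_coeff_finSuccEquiv,
      coeff_coeff_splitFirstFun]
    -- `finSuccEquiv` nests the variables in the opposite order; the two product formulas differ by
    -- interchanging the antidiagonal sums.
    exact Finset.sum_comm

theorem coeff_coeff_splitFirst (F : MvPowerSeries (Fin (l + 1)) R) (d : Fin l →₀ ℕ) (j : ℕ) :
    PowerSeries.coeff j (coeff d (splitFirst F)) = coeff (d.cons j) F :=
  coeff_coeff_splitFirstFun F d j

theorem splitFirst_injective :
    Function.Injective (splitFirst : MvPowerSeries (Fin (l + 1)) R →+* _) := by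
  intro F G h
  ext d
  rw [← Finsupp.cons_tail d, ← coeff_coeff_splitFirst, ← coeff_coeff_splitFirst, h]

/-- A polynomial in `x₁, …, x_l` with coefficients in `R[x₀]` as a polynomial in
`x₀, …, x_l`. -/
noncomputable def _root_.MvPolynomial.joinFirst :
    MvPolynomial (Fin l) (Polynomial R) →+* MvPolynomial (Fin (l + 1)) R :=
  MvPolynomial.eval₂Hom (Polynomial.aeval (MvPolynomial.X 0) :
    Polynomial R →ₐ[R] MvPolynomial (Fin (l + 1)) R).toRingHom fun i => MvPolynomial.X i.succ

theorem splitFirst_C (r : R) :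
    splitFirst (C r : MvPowerSeries (Fin (l + 1)) R) = C (PowerSeries.C r) := by
  classical
  ext d j
  rw [coeff_coeff_splitFirst, ← coeff_coeff_finSuccEquiv, finSuccEquiv_C, PowerSeries.coeff_C,
    coeff_C]
  by_cases hd : d = 0 <;> by_cases hj : j = 0 <;> simp [hd, hj, PowerSeries.coeff_C, coeff_C]

theorem splitFirst_X_zero :
    splitFirst (X 0 : MvPowerSeries (Fin (l + 1)) R) = C PowerSeries.X := by
  classical
  ext d j
  rw [coeff_coeff_splitFirst, ← coeff_coeff_finSuccEquiv, finSuccEquiv_X_zero,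
    PowerSeries.coeff_X, coeff_C]
  by_cases hd : d = 0 <;> by_cases hj : j = 1 <;> simp [hd, hj, PowerSeries.coeff_X, coeff_one]

theorem splitFirst_X_succ (i : Fin l) :
    splitFirst (X i.succ : MvPowerSeries (Fin (l + 1)) R) = X i := by
  classical
  ext d j
  rw [coeff_coeff_splitFirst, ← coeff_coeff_finSuccEquiv, finSuccEquiv_X_succ,
    PowerSeries.coeff_C, coeff_X]
  by_cases hd : d = Finsupp.single i 1 <;> by_cases hj : j = 0 <;>
    simp [hd, hj, PowerSeries.coeff_one, coeff_X]

theorem splitFirst_joinFirst (p : MvPolynomial (Fin l) (Polynomial R)) :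
    splitFirst (p.joinFirst : MvPowerSeries (Fin (l + 1)) R) =
      (p.map Polynomial.coeToPowerSeries.ringHom : MvPolynomial (Fin l) (PowerSeries R)) := by
  have : (splitFirst.comp MvPolynomial.coeToMvPowerSeries.ringHom).comp MvPolynomial.joinFirst =
      MvPolynomial.coeToMvPowerSeries.ringHom.comp
        (MvPolynomial.map (σ := Fin l) (Polynomial.coeToPowerSeries.ringHom (R := R))) := by
    refine MvPolynomial.ringHom_ext' ?_ ?_
    · refine Polynomial.ringHom_ext ?_ ?_
      · intro r
        simp [MvPolynomial.joinFirst, splitFirst_C, MvPolynomial.algebraMap_eq]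
      · simp [MvPolynomial.joinFirst, splitFirst_X_zero]
    · intro i
      simp [MvPolynomial.joinFirst, splitFirst_X_succ]
  exact RingHom.congr_fun this p

end SplitFirst

/-! ### Evaluating identities between series and polynomials -/

section Evaluation

variable {R σ : Type*} [CommRing R] [TopologicalSpace R] [IsTopologicalRing R] [Fintype σ]

theorem hasSum_coeff_mul_coe {f : MvPowerSeries σ R} {a : σ → R} {s : R}
    (hf : HasSum (fun d : σ →₀ ℕ => coeff d f * ∏ m, a m ^ d m) s) (q : MvPolynomial σ R) :
    HasSum (fun d : σ →₀ ℕ => coeff d (f * (q : MvPowerSeries σ R)) * ∏ m, a m ^ d m)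
      (s * q.eval a) := by
  classical
  induction q using MvPolynomial.induction_on' with
  | monomial e r =>
    rw [MvPolynomial.eval_monomial, Finsupp.prod_pow, MvPolynomial.coe_monomial]
    have hinj : Function.Injective fun d : σ →₀ ℕ => d + e := add_left_injective e
    rw [← hinj.hasSum_iff]
    · have hterm : (fun d : σ →₀ ℕ => coeff d (f * monomial e r) * ∏ m, a m ^ d m) ∘
          (fun d => d + e) = fun d => (coeff d f * ∏ m, a m ^ d m) * (r * ∏ m, a m ^ e m) := by
        ext d
        simp only [Function.comp_apply, Finsupp.add_apply, pow_add, Finset.prod_mul_distrib]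
        rw [coeff_add_mul_monomial]
        ring
      rw [hterm]
      exact hf.mul_right _
    · intro d hd
      rw [coeff_mul_monomial, if_neg, zero_mul]
      exact fun hle => hd ⟨d - e, tsub_add_cancel_of_le hle⟩
  | add p q hp hq =>
    simpa [mul_add, add_mul] using hp.add hq

theorem hasSum_coeff_coe (a : σ → R) (q : MvPolynomial σ R) :
    HasSum (fun d : σ →₀ ℕ => coeff d (q : MvPowerSeries σ R) * ∏ m, a m ^ d m) (q.eval a) := by
  classical
  have h1 : HasSum (fun d : σ →₀ ℕ => coeff d (1 : MvPowerSeries σ R) * ∏ m, a m ^ d m) 1 := by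
    convert hasSum_single (0 : σ →₀ ℕ) ?_ using 1
    · simp
    · intro d hd
      simp [coeff_one, hd]
  simpa using hasSum_coeff_mul_coe h1 q

theorem mul_eval_eq_eval_of_mul_eq [T2Space R] {f : MvPowerSeries σ R} {a : σ → R} {s : R}
    (hf : HasSum (fun d : σ →₀ ℕ => coeff d f * ∏ m, a m ^ d m) s) {p q : MvPolynomial σ R}
    (h : f * (q : MvPowerSeries σ R) = p) : s * q.eval a = p.eval a :=
  (hasSum_coeff_mul_coe hf q).unique (h ▸ hasSum_coeff_coe a p)

end Evaluation

end MvPowerSeries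

/-! ### Polynomials with exponents in a fixed finite set -/

namespace MvPolynomial

variable {R σ : Type*} [CommRing R]

/-- The polynomial with prescribed coefficients on a finite set of exponents. -/
noncomputable def ofCoeffs (s : Finset (σ →₀ ℕ)) (v : s → R) : MvPolynomial σ R :=
  ∑ e : s, monomial e.1 (v e)

theorem coeff_ofCoeffs (s : Finset (σ →₀ ℕ)) (v : s → R) (e : s) :
    coeff e.1 (ofCoeffs s v) = v e := by
  classical
  simp [ofCoeffs, coeff_sum, coeff_monomial]

theorem coeff_ofCoeffs_of_notMem (s : Finset (σ →₀ ℕ)) (v : s → R) {d : σ →₀ ℕ} (hd : d ∉ s) :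
    coeff d (ofCoeffs s v) = 0 := by
  classical
  rw [ofCoeffs, coeff_sum]
  refine Finset.sum_eq_zero fun e _ => ?_
  rw [coeff_monomial, if_neg]
  rintro rfl
  exact hd e.2

theorem ofCoeffs_ne_zero {s : Finset (σ →₀ ℕ)} {v : s → R} (hv : v ≠ 0) : ofCoeffs s v ≠ 0 := by
  contrapose! hv
  ext e
  rw [← coeff_ofCoeffs s v e, hv, coeff_zero, Pi.zero_apply]

theorem ofCoeffs_coeff {s : Finset (σ →₀ ℕ)} {p : MvPolynomial σ R} (hp : p.support ⊆ s) :
    ofCoeffs s (fun e => coeff e.1 p) = p := by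
  ext d
  by_cases hd : d ∈ s
  · exact coeff_ofCoeffs s _ ⟨d, hd⟩
  · rw [coeff_ofCoeffs_of_notMem _ _ hd]
    exact (notMem_support_iff.mp fun h => hd (hp h)).symm

theorem eval_ofCoeffs [Fintype σ] (s : Finset (σ →₀ ℕ)) (v : s → R) (a : σ → R) :
    eval a (ofCoeffs s v) = ∑ e : s, v e * ∏ m, a m ^ e.1 m := by
  simp [ofCoeffs, eval_monomial, Finsupp.prod_pow]

theorem _root_.MvPowerSeries.coeff_mul_ofCoeffs [DecidableEq σ] (f : MvPowerSeries σ R)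
    (s : Finset (σ →₀ ℕ)) (v : s → R) (d : σ →₀ ℕ) :
    MvPowerSeries.coeff d (f * (ofCoeffs s v : MvPowerSeries σ R)) =
      ∑ e : s, (if e.1 ≤ d then MvPowerSeries.coeff (d - e.1) f else 0) * v e := by
  rw [ofCoeffs, ← coeToMvPowerSeries.ringHom_apply, map_sum, Finset.mul_sum, map_sum]
  refine Finset.sum_congr rfl fun e _ => ?_
  rw [coeToMvPowerSeries.ringHom_apply, coe_monomial, MvPowerSeries.coeff_mul_monomial]
  split_ifs <;> simp

theorem _root_.MvPowerSeries.exists_mul_ofCoeffs_eq_coe [DecidableEq σ] (f : MvPowerSeries σ R)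
    (s : Finset (σ →₀ ℕ)) (v : s → R)
    (h : ∀ d ∉ s, ∑ e : s, (if e.1 ≤ d then MvPowerSeries.coeff (d - e.1) f else 0) * v e = 0) :
    ∃ p : MvPolynomial σ R, f * (ofCoeffs s v : MvPowerSeries σ R) = p := by
  refine ⟨ofCoeffs s fun e => MvPowerSeries.coeff e.1 (f * (ofCoeffs s v : MvPowerSeries σ R)), ?_⟩
  ext d
  rw [coeff_coe]
  by_cases hd : d ∈ s
  · exact (coeff_ofCoeffs s (fun e => MvPowerSeries.coeff e.1
      (f * (ofCoeffs s v : MvPowerSeries σ R))) ⟨d, hd⟩).symm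
  · rw [coeff_ofCoeffs_of_notMem _ _ hd, MvPowerSeries.coeff_mul_ofCoeffs, h d hd]

end MvPolynomial

/-! ### Descent of coefficients from power series to polynomials -/

namespace MvPowerSeries

/-- Descent of the coefficient field from `k⟦X⟧` to `k[X]`: a quotient of two polynomials over
`k⟦X⟧` whose values at the points of an infinite box are rational functions of `X` is a quotient of
two polynomials over `k[X]`. -/
theorem exists_mul_map_eq_map_of_isRationalFunction {k : Type*} [Field k] {l : ℕ} {S : Set k}
    (hS : S.Infinite) {f : MvPowerSeries (Fin l) (PowerSeries k)}
    {p q : MvPolynomial (Fin l) (PowerSeries k)} (hq : q ≠ 0)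
    (hfq : f * (q : MvPowerSeries (Fin l) (PowerSeries k)) = p)
    (φ : (Fin l → k) → PowerSeries k)
    (hφ : ∀ a, (∀ m, a m ∈ S) →
      φ a * q.eval (fun m => PowerSeries.C (a m)) = p.eval (fun m => PowerSeries.C (a m)))
    (hrat : ∀ a, (∀ m, a m ∈ S) → (φ a).IsRationalFunction) :
    ∃ p' q' : MvPolynomial (Fin l) (Polynomial k), q' ≠ 0 ∧
      f * (q'.map Polynomial.coeToPowerSeries.ringHom : MvPolynomial (Fin l) (PowerSeries k)) =
        (p'.map Polynomial.coeToPowerSeries.ringHom : MvPolynomial (Fin l) (PowerSeries k)) := by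
  classical
  let ι : Polynomial k →+* PowerSeries k := Polynomial.coeToPowerSeries.ringHom
  have hι : Function.Injective ι := Polynomial.coe_injective k
  let ρ := {a : Fin l → k // ∀ m, a m ∈ S}
  let s := q.support ∪ p.support
  choose u w hw huw using fun a : ρ => (PowerSeries.isRationalFunction_iff _).mp (hrat a.1 a.2)
  let mon : ρ → s → k := fun a e => ∏ m, a.1 m ^ e.1 m
  -- With `φ a = u a / w a`, row `a` is the equation `w a * p(a) - u a * q(a) = 0` in the unknown
  -- coefficients of `p` and `q`.
  let M : Matrix ρ (s ⊕ s) (Polynomial k) := fun a =>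
    Sum.elim (fun e => w a * Polynomial.C (mon a e)) (fun e => -u a * Polynomial.C (mon a e))
  have hMl (a : ρ) (e : s) : M a (Sum.inl e) = w a * Polynomial.C (mon a e) := rfl
  have hMr (a : ρ) (e : s) : M a (Sum.inr e) = -u a * Polynomial.C (mon a e) := rfl
  have hιC (x : k) : ι (Polynomial.C x) = PowerSeries.C x := Polynomial.coe_C x
  have heval (a : ρ) (v : s → PowerSeries k) :
      (MvPolynomial.ofCoeffs s v).eval (fun m => PowerSeries.C (a.1 m)) =
        ∑ e : s, v e * PowerSeries.C (mon a e) := by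
    simp [MvPolynomial.eval_ofCoeffs, mon]
  have hpE := MvPolynomial.ofCoeffs_coeff (s := s) (p := p) Finset.subset_union_right
  have hqE := MvPolynomial.ofCoeffs_coeff (s := s) (p := q) Finset.subset_union_left
  have hdet (g : s ⊕ s → ρ) : (M.submatrix g id).det = 0 := by
    apply hι
    rw [map_zero, RingHom.map_det]
    refine Matrix.det_submatrix_eq_zero_of_mulVec_eq_zero (M.map ι)
      (v := Sum.elim (fun e => p.coeff e.1) (fun e => q.coeff e.1)) ?_ ?_ g
    · intro h0
      apply hq
      rw [← hqE]
      have : (fun e : s => q.coeff e.1) = 0 := funext fun e => congrFun h0 (Sum.inr e)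
      rw [this]
      simp [MvPolynomial.ofCoeffs]
    · ext1 a
      have h1 := hφ a.1 a.2
      rw [← hpE, ← hqE, heval, heval] at h1
      have h2 : φ a.1 * ι (w a) = ι (u a) := huw a
      have hsum : (M.map ι).mulVec (Sum.elim (fun e => p.coeff e.1) (fun e => q.coeff e.1)) a =
          ι (w a) * (∑ e : s, p.coeff e.1 * PowerSeries.C (mon a e)) -
            ι (u a) * ∑ e : s, q.coeff e.1 * PowerSeries.C (mon a e) := by
        simp only [Matrix.mulVec, dotProduct, Fintype.sum_sum_type, Matrix.map_apply, hMl, hMr,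
          Sum.elim_inl, Sum.elim_inr, map_mul, map_neg, hιC, Finset.mul_sum]
        rw [sub_eq_add_neg, ← Finset.sum_neg_distrib]
        congr 1 <;> exact Finset.sum_congr rfl fun e _ => by ring
      rw [hsum, ← h1, ← h2, Pi.zero_apply]
      ring
  obtain ⟨v, hv, hMv⟩ := M.exists_mulVec_eq_zero_of_forall_det_eq_zero hdet
  let p' := MvPolynomial.ofCoeffs s fun e => v (Sum.inl e)
  let q' := MvPolynomial.ofCoeffs s fun e => v (Sum.inr e)
  have hmap (v : s → Polynomial k) :
      (MvPolynomial.ofCoeffs s v).map ι = MvPolynomial.ofCoeffs s fun e => ι (v e) := by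
    simp [MvPolynomial.ofCoeffs, map_sum, MvPolynomial.map_monomial]
  have hval (a : ρ) : φ a.1 * (q'.map ι).eval (fun m => PowerSeries.C (a.1 m)) =
      (p'.map ι).eval (fun m => PowerSeries.C (a.1 m)) := by
    have hw0 : ι (w a) ≠ 0 := (map_ne_zero_iff ι hι).mpr (hw a)
    apply mul_left_cancel₀ hw0
    have h2 : φ a.1 * ι (w a) = ι (u a) := huw a
    have h3 : (∑ e : s, w a * Polynomial.C (mon a e) * v (Sum.inl e)) +
        ∑ e : s, -u a * Polynomial.C (mon a e) * v (Sum.inr e) = 0 := by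
      have := congrFun hMv a
      simpa only [Matrix.mulVec, dotProduct, Fintype.sum_sum_type, hMl, hMr,
        Pi.zero_apply] using this
    have h4 := congrArg ι h3
    simp only [map_add, map_sum, map_mul, map_neg, hιC, map_zero] at h4
    rw [hmap, hmap, heval, heval, ← mul_assoc, mul_comm (ι (w a)), h2, Finset.mul_sum,
      Finset.mul_sum, ← sub_eq_zero, ← neg_eq_zero, ← h4, neg_sub, sub_eq_add_neg,
      ← Finset.sum_neg_distrib]
    congr 1 <;> exact Finset.sum_congr rfl fun e _ => by ring
  -- Both sides take the value `φ a * q(a) * q'(a)` on an infinite box, so no nonvanishing of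
  -- denominators is needed.
  have hcross : p'.map ι * q = p * q'.map ι := by
    refine MvPolynomial.funext_set (fun _ => PowerSeries.C '' S)
      (fun _ => hS.image (PowerSeries.C_injective.injOn)) ?_
    intro x hx
    choose a haS hax using fun m => hx m (Set.mem_univ m)
    obtain rfl : (fun m => PowerSeries.C (a m)) = x := funext hax
    rw [map_mul, map_mul, ← hval ⟨a, haS⟩, ← hφ a haS]
    ring
  have hmapinj : Function.Injective (MvPolynomial.map (σ := Fin l) ι) :=
    MvPolynomial.map_injective ι hι
  have hq' : q' ≠ 0 := by
    intro h0
    rw [h0, map_zero, mul_zero] at hcross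
    have hp0 : p' = 0 :=
      (map_eq_zero_iff _ hmapinj).mp ((mul_eq_zero.mp hcross).resolve_right hq)
    apply hv
    ext1 (e | e)
    · rw [← MvPolynomial.coeff_ofCoeffs s (fun e => v (Sum.inl e)) e]
      change MvPolynomial.coeff _ p' = _
      rw [hp0, MvPolynomial.coeff_zero, Pi.zero_apply]
    · rw [← MvPolynomial.coeff_ofCoeffs s (fun e => v (Sum.inr e)) e]
      change MvPolynomial.coeff _ q' = _
      rw [h0, MvPolynomial.coeff_zero, Pi.zero_apply]
  refine ⟨p', q', hq', ?_⟩
  have hq0 : (q : MvPowerSeries (Fin l) (PowerSeries k)) ≠ 0 := by simpa using hq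
  apply mul_right_cancel₀ hq0
  rw [mul_right_comm, hfq, ← MvPolynomial.coe_mul, ← MvPolynomial.coe_mul]
  exact congrArg _ hcross.symm

/-! ### Substituting for the first variable -/

section Ultrametric

variable {k : Type*} [NormedField k] {l : ℕ}

theorem IsRestricted.tendsto_coeff {σ : Type*} {F : MvPowerSeries σ k}
    (hF : IsRestricted (fun _ => 1) F) : Tendsto (fun d => coeff d F) cofinite (𝓝 0) := by
  rw [tendsto_zero_iff_norm_tendsto_zero]
  simpa [IsRestricted, Finsupp.prod] using hF

/-- Substitution of `x` for the first variable. -/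
noncomputable def evalFirst (F : MvPowerSeries (Fin (l + 1)) k) (x : k) :
    MvPowerSeries (Fin l) k :=
  fun d => ∑' j, coeff (d.cons j) F * x ^ j

theorem coeff_evalFirst (F : MvPowerSeries (Fin (l + 1)) k) (x : k) (d : Fin l →₀ ℕ) :
    coeff d (F.evalFirst x) = ∑' j, coeff (d.cons j) F * x ^ j := rfl

variable [IsUltrametricDist k]

theorem coeff_splitFirst_mem_subring {F : MvPowerSeries (Fin (l + 1)) k}
    (hF : IsRestricted (fun _ => 1) F) (d : Fin l →₀ ℕ) :
    coeff d (splitFirst F) ∈ PowerSeries.IsRestricted.subring (R := k) 1 := by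
  change PowerSeries.IsRestricted 1 _
  rw [PowerSeries.isRestricted_iff]
  simp only [one_pow, mul_one, coeff_coeff_splitFirst]
  refine (tendsto_zero_iff_norm_tendsto_zero.mp hF.tendsto_coeff).comp
    (Function.Injective.tendsto_cofinite (f := fun j => d.cons j) ?_)
  exact fun i j hij => (Finsupp.cons_injective2 hij).1

theorem tendsto_coeff_cons {F : MvPowerSeries (Fin (l + 1)) k}
    (hF : IsRestricted (fun _ => 1) F) (d : Fin l →₀ ℕ) :
    Tendsto (fun j => coeff (d.cons j) F) atTop (𝓝 0) := by
  simpa only [coeff_coeff_splitFirst] using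
    PowerSeries.IsRestricted.tendsto_coeff (coeff_splitFirst_mem_subring hF d)

variable [CompleteSpace k]

open PowerSeries.IsRestricted in
/-- A power series with restricted coefficients which, specialized at infinitely many points, is a
quotient of polynomials with exponents in a fixed finite set is a quotient of polynomials. -/
theorem exists_mul_eq_coe_of_infinite {σ : Type*} [DecidableEq σ]
    {f : MvPowerSeries σ (PowerSeries k)} (hf : ∀ d, coeff d f ∈ subring (R := k) 1)
    (s : Finset (σ →₀ ℕ)) {T : Set k} (hT : T.Infinite) (hT1 : ∀ x ∈ T, ‖x‖ ≤ 1)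
    (h : ∀ x (hx : x ∈ T), ∃ v : s → k, v ≠ 0 ∧ ∀ d ∉ s, ∑ e : s,
      (if e.1 ≤ d then evalHom x (hT1 x hx) ⟨coeff (d - e.1) f, hf _⟩ else 0) * v e = 0) :
    ∃ p q : MvPolynomial σ (PowerSeries k), q ≠ 0 ∧
      f * (q : MvPowerSeries σ (PowerSeries k)) = p := by
  classical
  -- Kernel vectors are the denominators with exponents in `s` whose product with `f` has no
  -- coefficient outside `s`.
  let M : Matrix {d // d ∉ s} s (subring (R := k) 1) := fun d e =>
    if e.1 ≤ d.1 then ⟨coeff (d.1 - e.1) f, hf _⟩ else 0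
  have hM (d : {d // d ∉ s}) (e : s) :
      M d e = if e.1 ≤ d.1 then ⟨coeff (d.1 - e.1) f, hf _⟩ else 0 := rfl
  have hdet (g : s → {d // d ∉ s}) : (M.submatrix g id).det = 0 := by
    refine eq_zero_of_infinite_evalHom_eq_zero _ hT fun x hx => ⟨hT1 x hx, ?_⟩
    obtain ⟨v, hv, hv0⟩ := h x hx
    rw [RingHom.map_det]
    refine Matrix.det_submatrix_eq_zero_of_mulVec_eq_zero (M.map (evalHom x (hT1 x hx))) hv ?_ g
    ext d
    rw [Pi.zero_apply, ← hv0 d.1 d.2]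
    refine Finset.sum_congr rfl fun e _ => ?_
    simp only [Matrix.map_apply, hM]
    split_ifs <;> simp
  obtain ⟨v, hv, hMv⟩ := M.exists_mulVec_eq_zero_of_forall_det_eq_zero hdet
  obtain ⟨p, hp⟩ := f.exists_mul_ofCoeffs_eq_coe s (fun e => (v e : PowerSeries k)) (by
    intro d hd
    have := congrArg Subtype.val (congrFun hMv ⟨d, hd⟩)
    simp only [Matrix.mulVec, dotProduct, AddSubmonoidClass.coe_finsetSum, Subring.coe_mul,
      Pi.zero_apply, ZeroMemClass.coe_zero] at this
    refine Eq.trans ?_ this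
    refine Finset.sum_congr rfl fun e _ => ?_
    rw [hM]
    split_ifs <;> rfl)
  refine ⟨p, _, MvPolynomial.ofCoeffs_ne_zero ?_, hp⟩
  intro h0
  apply hv
  ext1 e
  exact Subtype.ext (congrFun h0 e)

theorem coeff_evalFirst_eq_evalHom {F : MvPowerSeries (Fin (l + 1)) k}
    (hF : IsRestricted (fun _ => 1) F) (x : k) (hx : ‖x‖ ≤ 1) (d : Fin l →₀ ℕ) :
    coeff d (F.evalFirst x) = PowerSeries.IsRestricted.evalHom x hx
      ⟨coeff d (splitFirst F), coeff_splitFirst_mem_subring hF d⟩ := by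
  rw [coeff_evalFirst]
  exact tsum_congr fun j => by rw [coeff_coeff_splitFirst]

/-- A coefficient of size at least `ε` needs a term of size at least `ε`, so the large coefficients
sit at tails of finitely many exponents. -/
theorem isRestricted_evalFirst {F : MvPowerSeries (Fin (l + 1)) k}
    (hF : IsRestricted (fun _ => 1) F) {x : k} (hx : ‖x‖ ≤ 1) :
    IsRestricted (fun _ => 1) (F.evalFirst x) := by
  suffices Tendsto (fun d => ‖coeff d (F.evalFirst x)‖) cofinite (𝓝 0) by
    simpa [IsRestricted, Finsupp.prod] using this
  rw [← tendsto_zero_iff_norm_tendsto_zero, Metric.tendsto_nhds]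
  intro ε hε
  have hfin := Metric.tendsto_nhds.mp hF.tendsto_coeff ε hε
  rw [eventually_cofinite] at hfin ⊢
  refine (hfin.image Finsupp.tail).subset fun d hd => ?_
  by_contra hcon
  apply hd
  rw [dist_zero_right, coeff_evalFirst]
  refine norm_tsum_lt (summable_mul_pow (tendsto_coeff_cons hF d) hx).tendsto_atTop_zero
    fun j => (norm_mul_pow_le _ hx _).trans_lt ?_
  by_contra hj
  exact hcon ⟨d.cons j, by simpa using hj, Finsupp.tail_cons _ _⟩

theorem _root_.Fin.prod_univ_erase_succ {M : Type*} [CommMonoid M] (n : Fin l)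
    (g : Fin (l + 1) → M) :
    ∏ m ∈ Finset.univ.erase n.succ, g m = g 0 * ∏ m ∈ Finset.univ.erase n, g m.succ := by
  have : Finset.univ.erase n.succ =
      insert 0 ((Finset.univ.erase n).map (Fin.succEmb l)) := by
    ext m
    cases m using Fin.cases <;> simp [Fin.succ_ne_zero, (Fin.succ_ne_zero _).symm]
  rw [this, Finset.prod_insert (by simp [Fin.succ_ne_zero]), Finset.prod_map]
  rfl

theorem _root_.Fin.prod_univ_erase_zero {M : Type*} [CommMonoid M] (g : Fin (l + 1) → M) :
    ∏ m ∈ Finset.univ.erase 0, g m = ∏ m : Fin l, g m.succ := by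
  have : Finset.univ.erase 0 = Finset.univ.map (Fin.succEmb l) := by
    ext m
    cases m using Fin.cases <;> simp [Fin.succ_ne_zero]
  rw [this, Finset.prod_map]
  rfl

/-- Multi-indices with a prescribed entry at a nonzero position, split into their first entry
and the rest. -/
noncomputable def consFiberEquiv (n : Fin l) (j : ℕ) :
    {d : Fin l →₀ ℕ // d n = j} × ℕ ≃ {d : Fin (l + 1) →₀ ℕ // d n.succ = j} where
  toFun p := ⟨p.1.1.cons p.2, by rw [Finsupp.cons_succ]; exact p.1.2⟩
  invFun d := (⟨d.1.tail, d.2⟩, d.1 0)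
  left_inv p := by simp
  right_inv d := by simp

/-- Multi-indices with a prescribed first entry are determined by the rest. -/
noncomputable def consZeroFiberEquiv (j : ℕ) :
    (Fin l →₀ ℕ) ≃ {d : Fin (l + 1) →₀ ℕ // d 0 = j} where
  toFun d := ⟨d.cons j, Finsupp.cons_zero _ _⟩
  invFun d := d.1.tail
  left_inv d := Finsupp.tail_cons _ _
  right_inv d := by
    obtain ⟨d, rfl⟩ := d
    simp

theorem specializeExcept_evalFirst {F : MvPowerSeries (Fin (l + 1)) k}
    (hF : IsRestricted (fun _ => 1) F) (n : Fin l) (x : k) (hx : ‖x‖ ≤ 1) (a : Fin l → k)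
    (ha : ∀ m, ‖a m‖ ≤ 1) :
    (F.evalFirst x).specializeExcept n a = F.specializeExcept n.succ (Fin.cons x a) := by
  ext j
  simp only [specializeExcept, PowerSeries.coeff_mk]
  have hs := F.summable_specializeExcept hF n.succ (Fin.cons x a)
    (fun m => by cases m using Fin.cases <;> simp [hx, ha]) j
  rw [← (consFiberEquiv n j).tsum_eq]
  rw [← (consFiberEquiv n j).summable_iff] at hs
  refine Eq.trans ?_ hs.tsum_prod.symm
  refine tsum_congr fun d => ?_
  rw [coeff_evalFirst, ← tsum_mul_right]
  refine tsum_congr fun i => ?_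
  simp [consFiberEquiv, Fin.prod_univ_erase_succ, mul_assoc]

open scoped PowerSeries.WithPiTopology in
theorem hasSum_coeff_splitFirst {F : MvPowerSeries (Fin (l + 1)) k}
    (hF : IsRestricted (fun _ => 1) F) (a : Fin l → k) (ha : ∀ m, ‖a m‖ ≤ 1) :
    HasSum (fun d : Fin l →₀ ℕ => coeff d (splitFirst F) * ∏ m, PowerSeries.C (a m) ^ d m)
      (F.specializeExcept 0 (Fin.cons 0 a)) := by
  rw [PowerSeries.WithPiTopology.hasSum_iff_hasSum_coeff]
  intro j
  have hs := (F.summable_specializeExcept hF 0 (Fin.cons 0 a)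
    (fun m => by cases m using Fin.cases <;> simp [ha]) j).hasSum
  rw [← (consZeroFiberEquiv j).hasSum_iff] at hs
  simp only [specializeExcept, PowerSeries.coeff_mk]
  convert hs using 2 with d
  simp only [← map_pow, ← map_prod, PowerSeries.coeff_mul_C, coeff_coeff_splitFirst]
  simp [consZeroFiberEquiv, Fin.prod_univ_erase_zero]

end Ultrametric

end MvPowerSeries

/-! ### Uncountability and the induction -/

theorem not_countable_closedBall (k : Type*) [NontriviallyNormedField k] [CompleteSpace k] :
    ¬ (Metric.closedBall (0 : k) 1).Countable := by
  intro h
  have h1 := continuum_le_cardinal_of_isOpen k (Metric.isOpen_ball (x := (0 : k)) (ε := 1))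
    ⟨0, by simp⟩
  have h2 := Cardinal.le_aleph0_iff_set_countable.mpr (h.mono Metric.ball_subset_closedBall)
  exact absurd (h1.trans h2) (not_le.mpr Cardinal.aleph0_lt_continuum)

/-- If every point of an uncountable set is related to some element of a countable type, then some
element is related to infinitely many points. -/
theorem Set.exists_infinite_fiber_of_not_countable {α β : Type*} [Countable β] {S : Set α}
    (hS : ¬ S.Countable) (r : α → β → Prop) (h : ∀ x ∈ S, ∃ b, r x b) :
    ∃ b, {x | x ∈ S ∧ r x b}.Infinite := by
  by_contra! hfin
  apply hS
  refine (Set.countable_iUnion fun b => (hfin b).countable).mono fun x hx => ?_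
  obtain ⟨b, hb⟩ := h x hx
  exact Set.mem_iUnion.mpr ⟨b, hx, hb⟩

theorem proposition3p8 {k : Type*} [NontriviallyNormedField k] [IsUltrametricDist k]
    [CompleteSpace k] {l : ℕ} (F : MvPowerSeries (Fin l) k)
    (hF : MvPowerSeries.IsRestricted (fun _ => 1) F)
    (hrat : ∀ (n : Fin l) (a : Fin l → k), (∀ m, ‖a m‖ ≤ 1) →
      (F.specializeExcept n a).IsRationalFunction) :
    F.IsRationalFunction := by
  classical
  induction l with
  | zero =>
    rw [MvPowerSeries.isRationalFunction_iff]
    refine ⟨MvPolynomial.C (MvPowerSeries.coeff 0 F), 1, one_ne_zero, ?_⟩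
    ext d
    rw [Subsingleton.elim d 0]
    simp
  | succ l ih =>
    have hball := not_countable_closedBall k
    have hrat1 (x : k) (hx : ‖x‖ ≤ 1) : (F.evalFirst x).IsRationalFunction := by
      refine ih _ (MvPowerSeries.isRestricted_evalFirst hF hx) fun n a ha => ?_
      rw [MvPowerSeries.specializeExcept_evalFirst hF n x hx a ha]
      exact hrat _ _ fun m => by cases m using Fin.cases <;> simp [hx, ha]
    -- Only the exponent set is recorded, not the coefficients in `k`, because the pigeonhole needs
    -- a countable type.
    obtain ⟨s, hs⟩ := Set.exists_infinite_fiber_of_not_countable hball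
      (fun (x : k) (s : Finset (Fin l →₀ ℕ)) => ∃ v : s → k, v ≠ 0 ∧ ∀ d ∉ s, ∑ e : s,
        (if e.1 ≤ d then MvPowerSeries.coeff (d - e.1) (F.evalFirst x) else 0) * v e = 0) (by
      intro x hx
      obtain ⟨p, q, hq, hpq⟩ := (MvPowerSeries.isRationalFunction_iff _).mp
        (hrat1 x (by simpa using hx))
      have hqE := MvPolynomial.ofCoeffs_coeff (s := q.support ∪ p.support) (p := q)
        Finset.subset_union_left
      refine ⟨q.support ∪ p.support, fun e => q.coeff e.1, ?_, fun d hd => ?_⟩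
      · intro h0
        rw [h0] at hqE
        exact hq (hqE ▸ by simp [MvPolynomial.ofCoeffs])
      · rw [← MvPowerSeries.coeff_mul_ofCoeffs, hqE, hpq, MvPolynomial.coeff_coe]
        exact MvPolynomial.notMem_support_iff.mp fun h => hd (Finset.mem_union_right _ h))
    obtain ⟨p, q, hq, hpq⟩ := MvPowerSeries.exists_mul_eq_coe_of_infinite
      (MvPowerSeries.coeff_splitFirst_mem_subring hF) s hs (fun x hx => by simpa using hx.1)
      (fun x hx => by
        obtain ⟨v, hv, hv0⟩ := hx.2
        refine ⟨v, hv, fun d hd => ?_⟩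
        refine Eq.trans (Finset.sum_congr rfl fun e _ => ?_) (hv0 d hd)
        rw [MvPowerSeries.coeff_evalFirst_eq_evalHom hF x])
    have hinf : (Metric.closedBall (0 : k) 1).Infinite := fun h => hball h.countable
    open scoped PowerSeries.WithPiTopology in
    obtain ⟨p', q', hq', hpq'⟩ := MvPowerSeries.exists_mul_map_eq_map_of_isRationalFunction hinf
      hq hpq (fun a => F.specializeExcept 0 (Fin.cons 0 a))
      (fun a ha => MvPowerSeries.mul_eval_eq_eval_of_mul_eq
        (MvPowerSeries.hasSum_coeff_splitFirst hF a fun m => by simpa using ha m) hpq)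
      (fun a ha => hrat 0 _ fun m => by
        cases m using Fin.cases with
        | zero => simp
        | succ m => simpa using ha m)
    rw [MvPowerSeries.isRationalFunction_iff]
    rw [← MvPowerSeries.splitFirst_joinFirst, ← MvPowerSeries.splitFirst_joinFirst,
      ← map_mul] at hpq'
    refine ⟨p'.joinFirst, q'.joinFirst, fun h0 => hq' ?_, MvPowerSeries.splitFirst_injective hpq'⟩
    have h1 := MvPowerSeries.splitFirst_joinFirst q'
    rw [h0, MvPolynomial.coe_zero, map_zero, eq_comm, MvPolynomial.coe_eq_zero_iff] at h1
    exact (map_eq_zero_iff _ (MvPolynomial.map_injective _ (Polynomial.coe_injective k))).mp h1
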